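/- A graph $G$ is an interval graph if its vertices can be assigned nonempty closed intervals $I_v=[a_v,b_v]\subset\mathbb R$ ($a_v\le b_v$) such that distinct vertices $v,w$ are adjacent if and only if $I_v\cap I_w\neq\emptyset$. For finite graphs $F,G$ let $t(F,G)$ be the probability that a uniformly random map $V(F)\to V(G)$ is a graph homomorphism. A graph limit $\Gamma$ is identified with the family $(t(F,\Gamma))_F$, and the families that occur are exactly the pointwise limits of $(t(F,H_n))_F$ along sequences of finite graphs $H_n$ with $|V(H_n)|\to\infty$; $G_n\to\Gamma$ means that $|V(G_n)|\to\infty$ and $t(F,G_n)\to t(F,\Gamma)$ for every finite graph $F$. Let $\mathcal S=\{[a,b]:0\le a\le b\le 1\}$, with the Borel structure of the triangle $\{(a,b):0\le a\le b\le1\}\subset\mathbb R^2$, and let $W(I,J)=\mathbf 1\{I\cap J\ne\emptyset\}$ for $I,J\in\mathcal S$. A Borel probability measure $\mu$ on $\mathcal S$ represents $\Gamma$ if, for every finite graph $F$, $$t(F,\Gamma)=\int_{\mathcal S^{V(F)}}\prod_{ij\in E(F)}W(x_i,x_j)\,\prod_{i\in V(F)}d\mu(x_i).$$ Put $\omega(\mu)=\sup_{a\in[0,1]}\mu\{I\in\mathcal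 S: a\in I\}$. Let $\chi(G)$ and $\omega(G)$ denote the chromatic number and the clique number of a graph $G$. **Theorem.** Let $(G_n)$ be a sequence of interval graphs, $G_n$ having $n$ vertices, and suppose that $G_n\to\Gamma$ for some graph limit $\Gamma$. Then $\Gamma$ is represented by some probability measure on $\mathcal S$, and $\omega(\mu)$ is the same for all probability measures $\mu$ representing $\Gamma$; denote this common value by $\omega(\Gamma)$. Moreover $\chi(G_n)=\omega(G_n)$ for every $n$, and $$\frac1n\chi(G_n)=\frac1n\omega(G_n)\to\omega(\Gamma)\qquad(n\to\infty).$$ -/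

import Mathlib

open Filter Topology MeasureTheory

noncomputable section

namespace IntervalGraphLimits

/-- A graph is an interval graph if its vertices can be assigned closed bounded nonempty intervals
`[a v, b v]` of the real line so that two distinct vertices are adjacent exactly when their
intervals meet. Degenerate intervals `[a, a]` are allowed. -/
def IsIntervalGraph {V : Type*} (G : SimpleGraph V) : Prop :=
  ∃ a b : V → ℝ, (∀ v, a v ≤ b v) ∧
    ∀ v w, v ≠ w → (G.Adj v w ↔ (Set.Icc (a v) (b v) ∩ Set.Icc (a w) (b w)).Nonempty)

/-- The homomorphism density `t(F, G)`: the probability that a uniformly random map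
`V(F) → V(G)` is a graph homomorphism. -/
def homDensity {k : ℕ} (F : SimpleGraph (Fin k)) {V : Type*} [Fintype V]
    (G : SimpleGraph V) : ℝ :=
  (Nat.card (F →g G) : ℝ) / (Fintype.card V : ℝ) ^ k

/-- A (proper) graph limit. It is identified with the family of its densities `t(F, Γ)`, and the
families that occur are exactly the limits of `t(F, G_n)` along sequences of finite graphs whose
numbers of vertices tend to infinity. -/
@[ext]
structure GraphLimit where
  /-- The density `t(F, Γ)`, for every finite graph `F`. -/
  density : ∀ {k : ℕ}, SimpleGraph (Fin k) → ℝ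
  isLimit : ∃ (m : ℕ → ℕ) (G : ∀ n, SimpleGraph (Fin (m n))), Tendsto m atTop atTop ∧
    ∀ (k : ℕ) (F : SimpleGraph (Fin k)),
      Tendsto (fun n => homDensity F (G n)) atTop (𝓝 (density F))

/-- `G_n → Γ`: the numbers of vertices tend to infinity, and `t(F, G_n) → t(F, Γ)` for every
finite graph `F`. -/
def ConvergesTo {V : ℕ → Type*} [∀ n, Fintype (V n)] (G : ∀ n, SimpleGraph (V n))
    (Γ : GraphLimit) : Prop :=
  Tendsto (fun n => Fintype.card (V n)) atTop atTop ∧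
    ∀ (k : ℕ) (F : SimpleGraph (Fin k)),
      Tendsto (fun n => homDensity F (G n)) atTop (𝓝 (Γ.density F))

/-- The space `𝒮` of nonempty closed subintervals `[a, b]` of `[0, 1]`, as the triangle
`0 ≤ a ≤ b ≤ 1` in the plane, with its usual topology and Borel sets. -/
abbrev IntervalSpace : Type := {p : ℝ × ℝ // 0 ≤ p.1 ∧ p.1 ≤ p.2 ∧ p.2 ≤ 1}

/-- The interval itself, as a set of reals. -/
def IntervalSpace.toSet (I : IntervalSpace) : Set ℝ := Set.Icc I.1.1 I.1.2

open Classical in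
/-- The kernel `W(I, J) = 1` if `I ∩ J ≠ ∅`, and `0` otherwise. -/
def kernelW (I J : IntervalSpace) : ℝ := if (I.toSet ∩ J.toSet).Nonempty then 1 else 0

open Classical in
/-- The density `t(F, Γ_μ) = ∫ ∏_{ij ∈ E(F)} W(x_i, x_j) dμ(x_1) ⋯ dμ(x_k)`; each edge `ij` is
listed once, with `i < j`. -/
def measureDensity (μ : ProbabilityMeasure IntervalSpace) {k : ℕ} (F : SimpleGraph (Fin k)) : ℝ :=
  ∫ x : Fin k → IntervalSpace,
    ∏ e ∈ Finset.univ.filter (fun e : Fin k × Fin k => e.1 < e.2 ∧ F.Adj e.1 e.2),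
      kernelW (x e.1) (x e.2)
    ∂(Measure.pi fun _ => (μ : Measure IntervalSpace))

/-- `μ` represents `Γ`, that is, `Γ = Γ_μ`. -/
def Represents (μ : ProbabilityMeasure IntervalSpace) (Γ : GraphLimit) : Prop :=
  ∀ (k : ℕ) (F : SimpleGraph (Fin k)), Γ.density F = measureDensity μ F

/-- `ω(μ) = sup_{a ∈ [0, 1]} μ{I : a ∈ I}`. -/
def measureCliqueNumber (μ : ProbabilityMeasure IntervalSpace) : ℝ :=
  ⨆ a : Set.Icc (0 : ℝ) 1, (μ : Measure IntervalSpace).real {I | (a : ℝ) ∈ I.toSet}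

open Classical in
/-- `ω(Γ)`: the value `ω(μ)` for some measure `μ` representing `Γ` (and `0` if there is none). -/
def GraphLimit.cliqueNumber (Γ : GraphLimit) : ℝ :=
  if h : ∃ μ, Represents μ Γ then measureCliqueNumber h.choose else 0

end IntervalGraphLimits

end

namespace IntervalGraphLimits

/-! ### The space of intervals -/

/-! Clique densities determine the clique number. Independent intervals through a common point form
a clique, so `ω(μ)^k ≤ t(K_k, μ)`. Conversely, in a family of pairwise meeting intervals the largest
left endpoint lies in all of them, so a union bound gives `t(K_{k+1}, μ) ≤ (k+1) ω(μ)^k`. For large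
`k` the factor `k+1` is negligible: these bounds pin `ω(μ)` down from the densities alone
(`Represents.eq_measureCliqueNumber`), and they pass to limits of densities.

A representing measure is a weak cluster point of the empirical measures of interval models of
`G_n`. The kernel is discontinuous where intervals only touch, so the models are first normalised to
have right endpoints that are distinct multiples of `1/n`. The limiting law of the right endpoint
then has no atoms, touching is a null event, and densities pass to the limit
(`tendsto_measureDensity`). Empirical and homomorphism densities differ only through non-injective
maps, which are negligible.

At finite level Helly's theorem gives `ω(empirical) = ω(G_n)/n`, and greedy colouring gives `χ = ω`.
-/

theorem toSet_inter_nonempty_iff (I J : IntervalSpace) :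
    (I.toSet ∩ J.toSet).Nonempty ↔ I.1.1 ≤ J.1.2 ∧ J.1.1 ≤ I.1.2 := by
  rw [IntervalSpace.toSet, IntervalSpace.toSet, Set.Icc_inter_Icc, Set.nonempty_Icc]
  simp only [sup_le_iff, le_inf_iff]
  exact ⟨fun h => ⟨h.2.1, h.1.2⟩, fun h => ⟨⟨I.2.2.1, h.2⟩, h.1, J.2.2.1⟩⟩

instance : CompactSpace IntervalSpace := by
  have h : IsClosed {p : ℝ × ℝ | 0 ≤ p.1 ∧ p.1 ≤ p.2 ∧ p.2 ≤ 1} :=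
    (isClosed_le continuous_const continuous_fst).inter
      ((isClosed_le continuous_fst continuous_snd).inter
        (isClosed_le continuous_snd continuous_const))
  refine isCompact_iff_compactSpace.1 (IsCompact.of_isClosed_subset
    (isCompact_Icc (a := ((0, 0) : ℝ × ℝ)) (b := (1, 1))) h fun p hp => ?_)
  obtain ⟨h1, h2, h3⟩ := hp
  exact ⟨⟨h1, h1.trans h2⟩, h2.trans h3, h3⟩

@[fun_prop]
theorem continuous_left : Continuous fun I : IntervalSpace => I.1.1 := by fun_prop

@[fun_prop]
theorem continuous_right : Continuous fun I : IntervalSpace => I.1.2 := by fun_prop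

theorem isClosed_setOf_mem_toSet (a : ℝ) : IsClosed {I : IntervalSpace | a ∈ I.toSet} :=
  (isClosed_le continuous_left continuous_const).inter
    (isClosed_le continuous_const continuous_right)

/-! ### Densities as measures of sets of homomorphisms -/

/-- The families of intervals, indexed by the vertices of `F`, that meet along every edge. -/
def meetingFamilies {k : ℕ} (F : SimpleGraph (Fin k)) : Set (Fin k → IntervalSpace) :=
  {x | ∀ i j, F.Adj i j → (x i).1.1 ≤ (x j).1.2}

theorem isClosed_meetingFamilies {k : ℕ} (F : SimpleGraph (Fin k)) :
    IsClosed (meetingFamilies F) := by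
  simp only [meetingFamilies, Set.ofPred_forall]
  exact isClosed_iInter fun i => isClosed_iInter fun j => isClosed_iInter fun _ =>
    isClosed_le (continuous_left.comp (continuous_apply i))
      (continuous_right.comp (continuous_apply j))

/-- Adjacency is symmetric, so the one inequality per ordered pair in `meetingFamilies` yields both
halves of the meeting condition, and the product of kernels is the indicator of that set. -/
theorem measureDensity_eq_real (μ : ProbabilityMeasure IntervalSpace) {k : ℕ}
    (F : SimpleGraph (Fin k)) :
    measureDensity μ F =
      (Measure.pi fun _ : Fin k => (μ : Measure IntervalSpace)).real (meetingFamilies F) := by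
  classical
  rw [← integral_indicator_one (isClosed_meetingFamilies F).measurableSet, measureDensity]
  congr 1
  ext x
  rw [Set.indicator_apply]
  split_ifs with h
  · refine Finset.prod_eq_one fun e he => ?_
    have he' : F.Adj e.1 e.2 := (Finset.mem_filter.1 he).2.2
    rw [kernelW, if_pos ((toSet_inter_nonempty_iff _ _).2 ⟨h _ _ he', h _ _ he'.symm⟩)]
  · simp only [meetingFamilies, Set.mem_ofPred_eq, not_forall] at h
    obtain ⟨i, j, hij, hlt⟩ := h
    rcases lt_or_gt_of_ne hij.ne with hl | hl
    · refine Finset.prod_eq_zero (i := (i, j)) (by simp [hl, hij]) ?_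
      rw [kernelW, if_neg fun hn => hlt ((toSet_inter_nonempty_iff _ _).1 hn).1]
    · refine Finset.prod_eq_zero (i := (j, i)) (by simp [hl, hij.symm]) ?_
      rw [kernelW, if_neg fun hn => hlt ((toSet_inter_nonempty_iff _ _).1 hn).2]

/-! ### Clique densities and the clique number of a measure -/

theorem bddAbove_real_mem_toSet (μ : ProbabilityMeasure IntervalSpace) :
    BddAbove (Set.range fun a : Set.Icc (0 : ℝ) 1 =>
      (μ : Measure IntervalSpace).real {I | (a : ℝ) ∈ I.toSet}) :=
  ⟨1, by rintro _ ⟨a, rfl⟩; exact measureReal_le_one⟩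

theorem real_mem_toSet_le_measureCliqueNumber (μ : ProbabilityMeasure IntervalSpace) {a : ℝ}
    (ha : a ∈ Set.Icc (0 : ℝ) 1) :
    (μ : Measure IntervalSpace).real {I | a ∈ I.toSet} ≤ measureCliqueNumber μ :=
  le_ciSup (bddAbove_real_mem_toSet μ) (⟨a, ha⟩ : Set.Icc (0 : ℝ) 1)

theorem measureCliqueNumber_nonneg (μ : ProbabilityMeasure IntervalSpace) :
    0 ≤ measureCliqueNumber μ :=
  Real.iSup_nonneg fun _ => measureReal_nonneg

theorem measureCliqueNumber_le_one (μ : ProbabilityMeasure IntervalSpace) :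
    measureCliqueNumber μ ≤ 1 := by
  have : Nonempty (Set.Icc (0 : ℝ) 1) := ⟨⟨0, by simp⟩⟩
  exact ciSup_le fun _ => measureReal_le_one

/-- Intervals sharing the point `a` meet pairwise, and `k` independent ones all contain `a` with
probability `μ{I : a ∈ I}^k`. -/
theorem measureCliqueNumber_pow_le (μ : ProbabilityMeasure IntervalSpace) (k : ℕ) :
    measureCliqueNumber μ ^ k ≤ measureDensity μ (⊤ : SimpleGraph (Fin k)) := by
  have : Nonempty (Set.Icc (0 : ℝ) 1) := ⟨⟨0, by simp⟩⟩
  rw [measureCliqueNumber, Real.iSup_pow fun _ => measureReal_nonneg, measureDensity_eq_real]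
  refine ciSup_le fun a => ?_
  have hpi : (Measure.pi fun _ : Fin k => (μ : Measure IntervalSpace)).real
      (Set.univ.pi fun _ => {I : IntervalSpace | (a : ℝ) ∈ I.toSet}) =
      (μ : Measure IntervalSpace).real {I | (a : ℝ) ∈ I.toSet} ^ k := by
    simp [measureReal_def, Measure.pi_pi]
  rw [← hpi]
  refine measureReal_mono fun x hx i j _ => ?_
  exact (hx i trivial).1.trans (hx j trivial).2

/-- The probability that all other intervals contain the left endpoint of the `i`-th one. -/
theorem real_pi_forall_left_mem_le (μ : ProbabilityMeasure IntervalSpace) {k : ℕ}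
    (i : Fin (k + 1)) :
    (Measure.pi fun _ : Fin (k + 1) => (μ : Measure IntervalSpace)).real
      {x | ∀ j, (x i).1.1 ∈ (x (i.succAbove j)).toSet} ≤ measureCliqueNumber μ ^ k := by
  have hm : MeasurableSet {p : IntervalSpace × (Fin k → IntervalSpace) |
      ∀ j, p.1.1.1 ∈ (p.2 j).toSet} := by
    simp only [IntervalSpace.toSet, Set.mem_Icc, Set.ofPred_forall]
    refine MeasurableSet.iInter fun j => IsClosed.measurableSet ?_
    have hj : Continuous fun p : IntervalSpace × (Fin k → IntervalSpace) => p.2 j := by fun_prop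
    exact (isClosed_le (continuous_left.comp hj) (continuous_left.comp continuous_fst)).inter
      (isClosed_le (continuous_left.comp continuous_fst) (continuous_right.comp hj))
  -- Fubini: once interval `i` is fixed, the other `k` are independent and must all contain a fixed
  -- point.
  have hpre := (measurePreserving_piFinSuccAbove
    (fun _ : Fin (k + 1) => (μ : Measure IntervalSpace)) i).measure_preimage hm.nullMeasurableSet
  refine ENNReal.toReal_le_of_le_ofReal (pow_nonneg (measureCliqueNumber_nonneg μ) k) ?_
  refine (le_of_eq hpre).trans ?_
  rw [Measure.prod_apply hm]
  calc _ ≤ ∫⁻ _ : IntervalSpace, ENNReal.ofReal (measureCliqueNumber μ ^ k)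
        ∂(μ : Measure IntervalSpace) := lintegral_mono fun y => ?_
    _ = _ := by simp
  have hy : y.1.1 ∈ Set.Icc (0 : ℝ) 1 := ⟨y.2.1, y.2.2.1.trans y.2.2.2⟩
  have hset : Prod.mk y ⁻¹' {p : IntervalSpace × (Fin k → IntervalSpace) |
      ∀ j, p.1.1.1 ∈ (p.2 j).toSet} =
      Set.univ.pi fun _ => {I : IntervalSpace | y.1.1 ∈ I.toSet} := by
    ext z; simp
  simp only [hset]
  rw [Measure.pi_pi, Finset.prod_const, Finset.card_univ, Fintype.card_fin,
    ENNReal.ofReal_pow (measureCliqueNumber_nonneg μ)]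
  gcongr
  rw [← ENNReal.ofReal_toReal (measure_ne_top (μ : Measure IntervalSpace) _)]
  exact ENNReal.ofReal_le_ofReal (real_mem_toSet_le_measureCliqueNumber μ hy)

/-- Union bound over which of the `k + 1` intervals has the largest left endpoint; all the others
contain that endpoint. -/
theorem measureDensity_top_le (μ : ProbabilityMeasure IntervalSpace) (k : ℕ) :
    measureDensity μ (⊤ : SimpleGraph (Fin (k + 1))) ≤ (k + 1) * measureCliqueNumber μ ^ k := by
  rw [measureDensity_eq_real]
  have hsub : meetingFamilies (⊤ : SimpleGraph (Fin (k + 1))) ⊆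
      ⋃ i ∈ (Finset.univ : Finset (Fin (k + 1))),
        {x | ∀ j, (x i).1.1 ∈ (x (i.succAbove j)).toSet} := by
    intro x hx
    obtain ⟨i, -, hi⟩ := Finset.exists_max_image Finset.univ (fun i => (x i).1.1)
      ⟨(0 : Fin (k + 1)), Finset.mem_univ _⟩
    simp only [Set.mem_iUnion]
    exact ⟨i, Finset.mem_univ _, fun j =>
      ⟨hi _ (Finset.mem_univ _), hx _ _ (Fin.succAbove_ne i j).symm⟩⟩
  calc _ ≤ _ := measureReal_mono hsub (measure_ne_top _ _)
    _ ≤ _ := measureReal_biUnion_finset_le _ _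
    _ ≤ ∑ _i : Fin (k + 1), measureCliqueNumber μ ^ k :=
        Finset.sum_le_sum fun i _ => real_pi_forall_left_mem_le μ i
    _ = _ := by simp

/-- If `y < x`, dividing by `x ^ k` gives `x ≤ (k + 1) * (y / x) ^ k`, which tends to `0`. -/
theorem le_of_forall_pow_succ_le_mul_pow {x y : ℝ} (hy : 0 ≤ y)
    (h : ∀ k : ℕ, x ^ (k + 1) ≤ (k + 1) * y ^ k) : x ≤ y := by
  by_contra! hlt
  have hx : 0 < x := hy.trans_lt hlt
  have hr : y / x < 1 := (div_lt_one hx).2 hlt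
  have hr0 : 0 ≤ y / x := by positivity
  have hlim : Tendsto (fun k : ℕ => (k : ℝ) * (y / x) ^ k + (y / x) ^ k) atTop (𝓝 (0 + 0)) :=
    (tendsto_self_mul_const_pow_of_lt_one hr0 hr).add (tendsto_pow_atTop_nhds_zero_of_lt_one hr0 hr)
  have hge : ∀ k : ℕ, x ≤ (k : ℝ) * (y / x) ^ k + (y / x) ^ k := fun k => by
    have := h k
    rw [div_pow, ← add_one_mul, mul_div_assoc', le_div_iff₀ (by positivity)]
    linarith [pow_succ' x k]
  have := ge_of_tendsto' hlim hge
  linarith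

/-- The clique number of a representing measure is determined by the clique densities. -/
theorem Represents.eq_measureCliqueNumber {μ : ProbabilityMeasure IntervalSpace} {Γ : GraphLimit}
    (h : Represents μ Γ) {x : ℝ} (hx : 0 ≤ x)
    (hlow : ∀ k, x ^ k ≤ Γ.density (⊤ : SimpleGraph (Fin k)))
    (hup : ∀ k : ℕ, Γ.density (⊤ : SimpleGraph (Fin (k + 1))) ≤ (k + 1) * x ^ k) :
    x = measureCliqueNumber μ := by
  refine le_antisymm (le_of_forall_pow_succ_le_mul_pow (measureCliqueNumber_nonneg μ) fun k => ?_)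
    (le_of_forall_pow_succ_le_mul_pow hx fun k => ?_)
  · exact (hlow _).trans (h _ _ ▸ measureDensity_top_le μ k)
  · exact (measureCliqueNumber_pow_le μ (k + 1)).trans (h _ _ ▸ hup k)

theorem Represents.cliqueNumber_eq {μ : ProbabilityMeasure IntervalSpace} {Γ : GraphLimit}
    (h : Represents μ Γ) : Γ.cliqueNumber = measureCliqueNumber μ := by
  have hex : ∃ μ, Represents μ Γ := ⟨μ, h⟩
  rw [GraphLimit.cliqueNumber, dif_pos hex]
  refine h.eq_measureCliqueNumber (measureCliqueNumber_nonneg _) (fun k => ?_) (fun k => ?_)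
  · rw [hex.choose_spec]; exact measureCliqueNumber_pow_le _ k
  · rw [hex.choose_spec]; exact measureDensity_top_le _ k

/-! ### Weak convergence and convergence of densities -/

/-- Fubini again: with all coordinates but `j` fixed, the right endpoint of interval `j` must hit
one given value. -/
theorem pi_setOf_left_eq_right_eq_zero (μ : ProbabilityMeasure IntervalSpace)
    (hμ : ∀ s : ℝ, (μ : Measure IntervalSpace) {I | I.1.2 = s} = 0) {k : ℕ} {i j : Fin k}
    (hij : i ≠ j) :
    (Measure.pi fun _ : Fin k => (μ : Measure IntervalSpace)) {x | (x i).1.1 = (x j).1.2} = 0 := by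
  obtain _ | k := k
  · exact i.elim0
  obtain ⟨l, rfl⟩ := Fin.exists_succAbove_eq hij
  have hm : MeasurableSet {p : IntervalSpace × (Fin k → IntervalSpace) |
      (p.2 l).1.1 = p.1.1.2} := by
    have hl : Continuous fun p : IntervalSpace × (Fin k → IntervalSpace) => p.2 l := by fun_prop
    exact (isClosed_eq (continuous_left.comp hl)
      (continuous_right.comp continuous_fst)).measurableSet
  have hpre := (measurePreserving_piFinSuccAbove
    (fun _ : Fin (k + 1) => (μ : Measure IntervalSpace)) j).measure_preimage hm.nullMeasurableSet
  refine (hpre : _ = _).trans ?_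
  rw [Measure.prod_apply_symm hm, lintegral_eq_zero_of_ae_eq_zero]
  refine Eventually.of_forall fun z => ?_
  refine (congrArg _ ?_).trans (hμ (z l).1.1)
  ext y
  exact eq_comm

/-- The families satisfying all the inequalities strictly form an open subset, so at a frontier
point some left endpoint equals the right endpoint of an adjacent interval. -/
theorem pi_frontier_meetingFamilies_eq_zero (μ : ProbabilityMeasure IntervalSpace)
    (hμ : ∀ s : ℝ, (μ : Measure IntervalSpace) {I | I.1.2 = s} = 0) {k : ℕ}
    (F : SimpleGraph (Fin k)) :
    (Measure.pi fun _ : Fin k => (μ : Measure IntervalSpace))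
      (frontier (meetingFamilies F)) = 0 := by
  have hopen : IsOpen {x : Fin k → IntervalSpace |
      ∀ i j, F.Adj i j → (x i).1.1 < (x j).1.2} := by
    simp only [Set.ofPred_forall]
    exact isOpen_iInter_of_finite fun i => isOpen_iInter_of_finite fun j =>
      isOpen_iInter_of_finite fun _ => isOpen_lt (continuous_left.comp (continuous_apply i))
        (continuous_right.comp (continuous_apply j))
  have hsub : frontier (meetingFamilies F) ⊆
      ⋃ i, ⋃ j, ⋃ (_ : F.Adj i j), {x : Fin k → IntervalSpace | (x i).1.1 = (x j).1.2} := by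
    intro x hx
    rw [(isClosed_meetingFamilies F).frontier_eq] at hx
    by_contra hne
    simp only [Set.mem_iUnion, not_exists] at hne
    exact hx.2 (interior_maximal (fun y hy i j hij => (hy i j hij).le) hopen
      fun i j hij => lt_of_le_of_ne (hx.1 i j hij) (hne i j hij))
  refine measure_mono_null hsub ?_
  simp only [measure_iUnion_null_iff]
  exact fun i j hij => pi_setOf_left_eq_right_eq_zero μ hμ hij.ne

theorem tendsto_measureDensity {ι : Type*} {l : Filter ι} {μs : ι → ProbabilityMeasure IntervalSpace}
    {μ : ProbabilityMeasure IntervalSpace} (h : Tendsto μs l (𝓝 μ))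
    (hμ : ∀ s : ℝ, (μ : Measure IntervalSpace) {I | I.1.2 = s} = 0) {k : ℕ}
    (F : SimpleGraph (Fin k)) :
    Tendsto (fun n => measureDensity (μs n) F) l (𝓝 (measureDensity μ F)) := by
  have hpi : Tendsto (fun n => ProbabilityMeasure.pi fun _ : Fin k => μs n) l
      (𝓝 (ProbabilityMeasure.pi fun _ : Fin k => μ)) :=
    (ProbabilityMeasure.continuous_pi.tendsto _).comp (tendsto_pi_nhds.2 fun _ => h)
  have key := ProbabilityMeasure.tendsto_measure_of_null_frontier_of_tendsto' hpi
    (pi_frontier_meetingFamilies_eq_zero μ hμ F)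
  simp only [measureDensity_eq_real]
  exact (ENNReal.tendsto_toReal (measure_ne_top _ _)).comp key

/-! ### Empirical measures -/

/-- The empirical distribution of a finite family of intervals. -/
noncomputable def empirical {n : ℕ} [NeZero n] (I : Fin n → IntervalSpace) :
    ProbabilityMeasure IntervalSpace :=
  ⟨(ProbabilityTheory.uniformOn (Set.univ : Set (Fin n))).map I,
    Measure.isProbabilityMeasure_map (measurable_of_finite I).aemeasurable⟩

theorem coe_empirical {n : ℕ} [NeZero n] (I : Fin n → IntervalSpace) :
    (empirical I : Measure IntervalSpace) =
      (ProbabilityTheory.uniformOn (Set.univ : Set (Fin n))).map I := rfl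

theorem uniformOn_univ_real {Ω : Type*} [Fintype Ω] [MeasurableSpace Ω] [MeasurableSingletonClass Ω]
    (s : Set Ω) :
    (ProbabilityTheory.uniformOn (Set.univ : Set Ω)).real s = Nat.card s / Fintype.card Ω := by
  rw [measureReal_def, ProbabilityTheory.uniformOn_univ, ENNReal.toReal_div,
    Measure.count_apply s.toFinite.measurableSet, ← s.toFinite.cast_ncard_eq,
    ENat.toENNReal_coe, ENNReal.toReal_natCast, ENNReal.toReal_natCast, Nat.card_coe_set_eq]

theorem empirical_real {n : ℕ} [NeZero n] (I : Fin n → IntervalSpace) {A : Set IntervalSpace}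
    (hA : MeasurableSet A) :
    (empirical I : Measure IntervalSpace).real A = Nat.card {v | I v ∈ A} / n := by
  rw [coe_empirical, map_measureReal_apply (measurable_of_finite I) hA, uniformOn_univ_real,
    Fintype.card_fin]
  rfl

theorem measureDensity_empirical {n : ℕ} [NeZero n] (I : Fin n → IntervalSpace) {k : ℕ}
    (F : SimpleGraph (Fin k)) :
    measureDensity (empirical I) F =
      Nat.card {f : Fin k → Fin n | I ∘ f ∈ meetingFamilies F} / (n : ℝ) ^ k := by
  have hpi : (Measure.pi fun _ : Fin k => (empirical I : Measure IntervalSpace)) =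
      (ProbabilityTheory.uniformOn (Set.univ : Set (Fin k → Fin n))).map fun f i => I (f i) := by
    have h1 := ProbabilityTheory.uniformOn_pi (ι := Fin k) (Ω := Fin n)
      (f := fun _ => Set.univ)
    rw [Set.pi_univ] at h1
    simp only [coe_empirical]
    rw [h1, Measure.pi_map_pi fun _ => (measurable_of_finite I).aemeasurable]
  rw [measureDensity_eq_real, hpi, map_measureReal_apply (measurable_of_finite _)
    (isClosed_meetingFamilies F).measurableSet, uniformOn_univ_real]
  simp
  rfl

/-- `I` represents `G` as an intersection graph of intervals. -/
def IsModel {V : Type*} (G : SimpleGraph V) (I : V → IntervalSpace) : Prop :=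
  ∀ v w, v ≠ w → (G.Adj v w ↔ (I v).1.1 ≤ (I w).1.2 ∧ (I w).1.1 ≤ (I v).1.2)

/-- There are `n.descFactorial k ≥ (n - k) ^ k` injective maps; for fixed `k` the bound tends to
`0`. -/
theorem card_not_injective_div_le {n k : ℕ} [NeZero n] (hk : k ≤ n) :
    (Nat.card {f : Fin k → Fin n | ¬ Function.Injective f} : ℝ) / (n : ℝ) ^ k ≤
      1 - (1 - k / n : ℝ) ^ k := by
  have hn : (0 : ℝ) < n := by exact_mod_cast Nat.pos_of_ne_zero (NeZero.ne n)
  classical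
  have hinj : Nat.card {f : Fin k → Fin n | Function.Injective f} = n.descFactorial k := by
    rw [Set.coe_ofPred, Nat.card_congr (Equiv.subtypeInjectiveEquivEmbedding (Fin k) (Fin n)),
      Nat.card_eq_fintype_card, Fintype.card_embedding_eq]
    simp
  have htot : Nat.card {f : Fin k → Fin n | ¬ Function.Injective f} + n.descFactorial k =
      n ^ k := by
    have hcompl := Set.ncard_add_ncard_compl {f : Fin k → Fin n | Function.Injective f}
    rw [Set.compl_ofPred] at hcompl
    rw [← hinj, add_comm, Nat.card_coe_set_eq, Nat.card_coe_set_eq, hcompl]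
    simp
  have hge : ((n : ℝ) - k) ^ k ≤ n.descFactorial k := by
    have h1 : (n - k) ^ k ≤ n.descFactorial k :=
      (Nat.pow_le_pow_left (by omega) k).trans (Nat.pow_sub_le_descFactorial n k)
    rw [← Nat.cast_sub hk]
    exact_mod_cast h1
  have htot' : (Nat.card {f : Fin k → Fin n | ¬ Function.Injective f} : ℝ) =
      (n : ℝ) ^ k - n.descFactorial k := by
    rw [eq_sub_iff_add_eq]; exact_mod_cast htot
  rw [htot', sub_div, div_self (by positivity)]
  gcongr
  rw [one_sub_div hn.ne', div_pow]
  gcongr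

theorem homDensity_le_measureDensity_empirical {n : ℕ} [NeZero n] {G : SimpleGraph (Fin n)}
    {I : Fin n → IntervalSpace} (hI : IsModel G I) {k : ℕ} (F : SimpleGraph (Fin k)) :
    homDensity F G ≤ measureDensity (empirical I) F := by
  rw [measureDensity_empirical, homDensity, Fintype.card_fin]
  gcongr
  refine Nat.card_le_card_of_injective
    (fun f : F →g G => (⟨f, fun i j hij => ?_⟩ : {f : Fin k → Fin n | I ∘ f ∈ meetingFamilies F}))
    fun f g h => DFunLike.coe_injective (congrArg Subtype.val h)
  have hadj := f.map_adj hij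
  exact ((hI _ _ hadj.ne).1 hadj).1

/-- Every interval meets itself while graphs have no loops, so a meeting family can fail to be a
homomorphism only when two vertices of `F` share an image. -/
theorem measureDensity_empirical_le {n : ℕ} [NeZero n] {G : SimpleGraph (Fin n)}
    {I : Fin n → IntervalSpace} (hI : IsModel G I) {k : ℕ} (F : SimpleGraph (Fin k)) :
    measureDensity (empirical I) F ≤ homDensity F G +
      (Nat.card {f : Fin k → Fin n | ¬ Function.Injective f} : ℝ) / (n : ℝ) ^ k := by
  rw [measureDensity_empirical, homDensity, Fintype.card_fin, ← add_div]
  gcongr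
  have hsub : {f : Fin k → Fin n | I ∘ f ∈ meetingFamilies F} ⊆
      Set.range (fun f : F →g G => (f : Fin k → Fin n)) ∪ {f | ¬ Function.Injective f} := by
    intro f hf
    by_cases hinj : Function.Injective f
    · refine Or.inl ⟨⟨f, fun {i j} hij => ?_⟩, rfl⟩
      exact (hI _ _ (hinj.ne hij.ne)).2 ⟨hf i j hij, hf j i hij.symm⟩
    · exact Or.inr hinj
  have hcard := (Set.ncard_le_ncard hsub).trans (Set.ncard_union_le _ _)
  have hrange : (Set.range (fun f : F →g G => (f : Fin k → Fin n))).ncard = Nat.card (F →g G) := by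
    rw [← Set.image_univ, Set.ncard_image_of_injective _ DFunLike.coe_injective, Set.ncard_univ]
  rw [hrange] at hcard
  exact_mod_cast hcard

theorem tendsto_measureDensity_empirical_sub_homDensity {G : ∀ n, SimpleGraph (Fin (n + 1))}
    {I : ∀ n, Fin (n + 1) → IntervalSpace} (hI : ∀ n, IsModel (G n) (I n)) {k : ℕ}
    (F : SimpleGraph (Fin k)) :
    Tendsto (fun n => measureDensity (empirical (I n)) F - homDensity F (G n)) atTop (𝓝 0) := by
  have hlim : Tendsto (fun n : ℕ => 1 - (1 - k / ((n + 1 : ℕ) : ℝ)) ^ k) atTop (𝓝 0) := by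
    have h0 : Tendsto (fun n : ℕ => (k : ℝ) / ((n + 1 : ℕ) : ℝ)) atTop (𝓝 0) :=
      (tendsto_const_div_atTop_nhds_zero_nat (k : ℝ)).comp (tendsto_add_atTop_nat 1)
    simpa using ((h0.const_sub 1).pow k).const_sub 1
  refine tendsto_of_tendsto_of_tendsto_of_le_of_le' tendsto_const_nhds hlim
    (Eventually.of_forall fun n => ?_) ((eventually_ge_atTop k).mono fun n hn => ?_)
  · exact sub_nonneg.2 (homDensity_le_measureDensity_empirical (hI n) F)
  · rw [sub_le_iff_le_add']
    refine (measureDensity_empirical_le (hI n) F).trans ?_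
    gcongr
    exact card_not_injective_div_le (by omega)

/-! ### Cliques and colourings of interval graphs -/

section Cliques

variable {n : ℕ} {G : SimpleGraph (Fin n)} {I : Fin n → IntervalSpace}

theorem IsModel.card_le_cliqueNum (hI : IsModel G I) {a : ℝ} {s : Finset (Fin n)}
    (hs : ∀ v ∈ s, a ∈ (I v).toSet) : s.card ≤ G.cliqueNum := by
  refine SimpleGraph.IsClique.card_le_cliqueNum (tc := fun v hv w hw hvw => ?_)
  exact (hI v w hvw).2 ⟨(hs v hv).1.trans (hs w hw).2, (hs w hw).1.trans (hs v hv).2⟩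

/-- **Helly's theorem** for the intervals of a clique. -/
theorem IsModel.exists_forall_mem_of_isClique (hI : IsModel G I) {s : Finset (Fin n)}
    (hs : G.IsClique s) : ∃ a ∈ Set.Icc (0 : ℝ) 1, ∀ v ∈ s, a ∈ (I v).toSet := by
  obtain rfl | hne := s.eq_empty_or_nonempty
  · exact ⟨0, by simp, by simp⟩
  obtain ⟨w, hw, hmax⟩ := s.exists_max_image (fun v => (I v).1.1) hne
  refine ⟨(I w).1.1, ⟨(I w).2.1, (I w).2.2.1.trans (I w).2.2.2⟩, fun v hv => ⟨hmax v hv, ?_⟩⟩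
  obtain rfl | hvw := eq_or_ne v w
  · exact (I v).2.2.1
  · exact ((hI v w hvw).1 (hs hv hw hvw)).2

/-- The vertices whose intervals contain a given point form a clique; by Helly every clique lies in
such a set. -/
theorem IsModel.measureCliqueNumber_empirical [NeZero n] (hI : IsModel G I) :
    measureCliqueNumber (empirical I) = (G.cliqueNum : ℝ) / n := by
  classical
  have hreal : ∀ a : ℝ, (empirical I : Measure IntervalSpace).real {J | a ∈ J.toSet} =
      ((Finset.univ.filter fun v => a ∈ (I v).toSet).card : ℝ) / n := fun a => by
    rw [empirical_real I (isClosed_setOf_mem_toSet a).measurableSet, Nat.card_eq_fintype_card,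
      Fintype.card_ofFinset]
    simp
  refine le_antisymm ?_ ?_
  · have : Nonempty (Set.Icc (0 : ℝ) 1) := ⟨⟨0, by simp⟩⟩
    refine ciSup_le fun a => ?_
    rw [hreal]
    gcongr
    exact hI.card_le_cliqueNum (a := a) fun v hv => (Finset.mem_filter.1 hv).2
  · obtain ⟨s, hs⟩ := G.exists_isNClique_cliqueNum
    obtain ⟨a, ha, hsa⟩ := hI.exists_forall_mem_of_isClique hs.isClique
    refine le_trans ?_ (real_mem_toSet_le_measureCliqueNumber _ ha)
    rw [hreal, ← hs.card_eq]
    gcongr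
    exact fun v hv => Finset.mem_filter.2 ⟨Finset.mem_univ _, hsa v hv⟩

/-- Greedy colouring in the order of the left endpoints. -/
theorem IsModel.exists_greedy_coloring (hI : IsModel G I) (s : Finset (Fin n)) :
    ∃ c : Fin n → ℕ, (∀ v ∈ s, c v < G.cliqueNum) ∧
      ∀ v ∈ s, ∀ w ∈ s, G.Adj v w → c v ≠ c w := by
  classical
  refine Finset.induction_on_max_value (fun v => (I v).1.1) s ⟨fun _ => 0, by simp, by simp⟩ ?_
  rintro v s hv hmax ⟨c, hc, hadj⟩
  set N := s.filter (G.Adj v) with hN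
  -- The coloured neighbours of `v` start no later than `v` and meet its interval, so they contain
  -- its left endpoint. Together with `v` they form a clique, which leaves a colour free.
  have hcard : (N.image c).card < (Finset.range G.cliqueNum).card := by
    have hins : (insert v N).card ≤ G.cliqueNum := by
      refine hI.card_le_cliqueNum (a := (I v).1.1) fun w hw => ?_
      obtain rfl | hw := Finset.mem_insert.1 hw
      · exact ⟨le_rfl, (I w).2.2.1⟩
      · obtain ⟨hws, hvw⟩ := Finset.mem_filter.1 hw
        exact ⟨hmax w hws, ((hI v w hvw.ne).1 hvw).1⟩
    rw [Finset.card_insert_of_notMem fun h => hv (Finset.mem_filter.1 h).1] at hins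
    rw [Finset.card_range]
    exact Finset.card_image_le.trans_lt hins
  obtain ⟨m, hm, hmN⟩ := Finset.exists_mem_notMem_of_card_lt_card hcard
  have hfree : ∀ w ∈ s, G.Adj v w → c w ≠ m := fun w hw hvw h =>
    hmN (Finset.mem_image.2 ⟨w, Finset.mem_filter.2 ⟨hw, hvw⟩, h⟩)
  have hupd : ∀ w ∈ s, Function.update c v m w = c w := fun w hw =>
    Function.update_of_ne (by rintro rfl; exact hv hw) _ _
  refine ⟨Function.update c v m, fun w hw => ?_, fun w hw u hu hwu => ?_⟩
  · obtain rfl | hw := Finset.mem_insert.1 hw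
    · simpa using hm
    · rw [hupd w hw]; exact hc w hw
  · rcases Finset.mem_insert.1 hw with rfl | hw' <;> rcases Finset.mem_insert.1 hu with rfl | hu'
    · exact absurd rfl hwu.ne
    · rw [hupd u hu', Function.update_self]; exact (hfree u hu' hwu).symm
    · rw [hupd w hw', Function.update_self]; exact hfree w hw' hwu.symm
    · rw [hupd w hw', hupd u hu']; exact hadj w hw' u hu' hwu

theorem IsModel.chromaticNumber_eq (hI : IsModel G I) :
    G.chromaticNumber = (G.cliqueNum : ℕ∞) := by
  refine le_antisymm ?_ G.cliqueNum_le_chromaticNumber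
  obtain ⟨c, hc, hadj⟩ := hI.exists_greedy_coloring Finset.univ
  refine SimpleGraph.Colorable.chromaticNumber_le ⟨SimpleGraph.Coloring.mk
    (fun v => (⟨c v, hc v (Finset.mem_univ v)⟩ : Fin G.cliqueNum)) fun {v w} h heq => ?_⟩
  exact hadj v (Finset.mem_univ v) w (Finset.mem_univ w) h (congrArg Fin.val heq)

end Cliques

/-! ### Normalised models -/

/-- `I` is a model whose right endpoints are distinct multiples of `1 / n`. -/
structure IsNormalizedModel {n : ℕ} (G : SimpleGraph (Fin n)) (I : Fin n → IntervalSpace) :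
    Prop where
  isModel : IsModel G I
  exists_rank : ∃ r : Fin n → ℕ, Function.Injective r ∧ ∀ v, (I v).1.2 = r v / n

/-- Adjacency depends only on the comparisons `a v ≤ b w`. These survive replacing `b w` by its rank
among right endpoints, ties broken by vertex label, and `a v` by one more than the number of right
endpoints strictly below it. Dividing by `n` lands in `[0, 1]`. -/
theorem IsIntervalGraph.exists_isNormalizedModel {n : ℕ} {G : SimpleGraph (Fin n)}
    (hG : IsIntervalGraph G) : ∃ I, IsNormalizedModel G I := by
  classical
  obtain ⟨a, b, hab, hadj⟩ := hG
  let lo : Fin n → Finset (Fin n) := fun v => Finset.univ.filter fun u => b u < a v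
  let hi : Fin n → Finset (Fin n) := fun w =>
    Finset.univ.filter fun u => b u < b w ∨ (b u = b w ∧ u ≤ w)
  have hle : ∀ {v w}, a v ≤ b w → (lo v).card + 1 ≤ (hi w).card := fun {v w} h => by
    rw [← Finset.card_insert_of_notMem (a := w) (s := lo v) (by simpa [lo] using h)]
    refine Finset.card_le_card fun u hu => ?_
    obtain rfl | hu := Finset.mem_insert.1 hu
    · simp [hi]
    · exact Finset.mem_filter.2 ⟨Finset.mem_univ _, Or.inl ((Finset.mem_filter.1 hu).2.trans_le h)⟩
  have hlt : ∀ {v w}, b w < a v → (hi w).card ≤ (lo v).card := fun {v w} h => by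
    refine Finset.card_le_card fun u hu => Finset.mem_filter.2 ⟨Finset.mem_univ _, ?_⟩
    rcases (Finset.mem_filter.1 hu).2 with h' | h'
    · exact h'.trans h
    · exact h'.1.trans_lt h
  have hiff : ∀ v w, (lo v).card + 1 ≤ (hi w).card ↔ a v ≤ b w := fun v w =>
    ⟨fun h => le_of_not_gt fun h' => absurd (hlt h') (by omega), hle⟩
  have hinj : Function.Injective fun w => (hi w).card := by
    have hmono : ∀ v w, (b v < b w ∨ (b v = b w ∧ v < w)) → (hi v).card < (hi w).card := by
      intro v w h
      refine Finset.card_lt_card (Finset.ssubset_iff.2 ⟨w, ?_, fun u hu => ?_⟩)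
      · simp only [hi, Finset.mem_filter, Finset.mem_univ, true_and]
        grind
      · simp only [hi, Finset.mem_insert, Finset.mem_filter, Finset.mem_univ, true_and] at hu ⊢
        grind
    intro v w h
    by_contra hne
    have h1 := fun h' => (hmono v w h').ne h
    have h2 := fun h' => (hmono w v h').ne h.symm
    rcases lt_trichotomy (b v) (b w) with hb | hb | hb
    · exact h1 (Or.inl hb)
    · rcases lt_or_gt_of_ne hne with hv | hv
      · exact h1 (Or.inr ⟨hb, hv⟩)
      · exact h2 (Or.inr ⟨hb.symm, hv⟩)
    · exact h2 (Or.inl hb)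
  have hhi : ∀ w, (hi w).card ≤ n := fun w => (Finset.card_le_univ _).trans_eq (Fintype.card_fin n)
  refine ⟨fun v => ⟨(((lo v).card + 1 : ℕ) / n, (hi v).card / n), by positivity, ?_, ?_⟩, ?_, ?_⟩
  · have := hle (hab v)
    dsimp only
    gcongr
  · exact div_le_one_of_le₀ (by exact_mod_cast hhi v) (by positivity)
  · intro v w hvw
    have hn : (0 : ℝ) < n := by exact_mod_cast v.pos
    simp only [div_le_div_iff_of_pos_right hn, Nat.cast_le, hiff]
    rw [hadj v w hvw, Set.Icc_inter_Icc, Set.nonempty_Icc]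
    simp only [sup_le_iff, le_inf_iff]
    exact ⟨fun h => ⟨h.2.1, h.1.2⟩, fun h => ⟨⟨hab v, h.2⟩, h.1, hab w⟩⟩
  · exact ⟨_, hinj, fun v => rfl⟩

/-- A window of length `2 * δ` contains at most `2 * δ * n + 1` multiples of `1 / n`, each the right
endpoint of at most one interval. -/
theorem IsNormalizedModel.empirical_real_le {n : ℕ} [NeZero n] {G : SimpleGraph (Fin n)}
    {I : Fin n → IntervalSpace} (hI : IsNormalizedModel G I) (s : ℝ) {δ : ℝ} (hδ : 0 ≤ δ) :
    (empirical I : Measure IntervalSpace).real {J | |J.1.2 - s| < δ} ≤ 2 * δ + 1 / n := by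
  classical
  obtain ⟨r, hr, hIr⟩ := hI.exists_rank
  have hn : (0 : ℝ) < n := by exact_mod_cast Nat.pos_of_ne_zero (NeZero.ne n)
  have hopen : IsOpen {J : IntervalSpace | |J.1.2 - s| < δ} :=
    isOpen_lt (by fun_prop) continuous_const
  rw [empirical_real I hopen.measurableSet, Nat.card_eq_fintype_card, Fintype.card_ofFinset,
    div_le_iff₀ hn]
  set A := Finset.univ.filter fun v => I v ∈ {J : IntervalSpace | |J.1.2 - s| < δ}
  have hcard : A.card ≤ (Finset.Icc ⌈n * (s - δ)⌉ ⌊n * (s + δ)⌋).card := by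
    refine Finset.card_le_card_of_injOn (fun v => (r v : ℤ)) (fun v hv => ?_)
      fun v _ w _ h => hr (Int.ofNat_inj.1 h)
    have hv' : |(I v).1.2 - s| < δ := (Finset.mem_filter.1 hv).2
    rw [hIr, abs_lt] at hv'
    have hrn : (n : ℝ) * (r v / n) = r v := by field_simp
    rw [Finset.mem_coe, Finset.mem_Icc, Int.ceil_le, Int.le_floor]
    push_cast
    constructor <;> nlinarith
  have hIcc : ((Finset.Icc ⌈n * (s - δ)⌉ ⌊n * (s + δ)⌋).card : ℝ) ≤ 2 * δ * n + 1 := by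
    rw [Int.card_Icc]
    rcases le_total 0 (⌊n * (s + δ)⌋ + 1 - ⌈n * (s - δ)⌉) with h | h
    · rw [← Int.cast_natCast, Int.toNat_of_nonneg h]
      push_cast
      linarith [Int.floor_le (n * (s + δ)), Int.le_ceil (n * (s - δ))]
    · rw [Int.toNat_of_nonpos h]
      simp only [Nat.cast_zero]
      positivity
  have h1 : (A.card : ℝ) ≤ 2 * δ * n + 1 := le_trans (by exact_mod_cast hcard) hIcc
  have h2 : (2 * δ + 1 / n) * n = 2 * δ * n + 1 := by field_simp
  rw [h2]
  refine le_of_eq_of_le ?_ h1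
  congr 2

/-! ### Existence of a representing measure and the main theorem -/

theorem measure_right_eq_zero_of_tendsto {G : ∀ n, SimpleGraph (Fin (n + 1))}
    {I : ∀ n, Fin (n + 1) → IntervalSpace} (hI : ∀ n, IsNormalizedModel (G n) (I n))
    {l : Filter ℕ} [l.NeBot] (hl : l ≤ atTop) {μ : ProbabilityMeasure IntervalSpace}
    (hμ : Tendsto (fun n => empirical (I n)) l (𝓝 μ)) (s : ℝ) :
    (μ : Measure IntervalSpace) {J | J.1.2 = s} = 0 := by
  -- The `3 * δ` is the bound `2 * δ + 1 / (n + 1)` once `1 / (n + 1) ≤ δ`; the portmanteau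
  -- inequality for open sets carries it to `μ`.
  have hle : ∀ δ : ℝ, 0 < δ → (μ : Measure IntervalSpace) {J | J.1.2 = s} ≤
      ENNReal.ofReal (3 * δ) := by
    intro δ hδ
    have hopen : IsOpen {J : IntervalSpace | |J.1.2 - s| < δ} :=
      isOpen_lt (by fun_prop) continuous_const
    have hev : ∀ᶠ n : ℕ in l, (empirical (I n) : Measure IntervalSpace) {J | |J.1.2 - s| < δ} ≤
        ENNReal.ofReal (3 * δ) := by
      have h0 := (tendsto_one_div_add_atTop_nhds_zero_nat (𝕜 := ℝ)).mono_left hl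
      filter_upwards [h0.eventually_le_const hδ] with n hn
      rw [← ENNReal.ofReal_toReal (measure_ne_top _ _)]
      refine ENNReal.ofReal_le_ofReal (((hI n).empirical_real_le s hδ.le).trans ?_)
      push_cast
      linarith
    calc (μ : Measure IntervalSpace) {J | J.1.2 = s}
        ≤ (μ : Measure IntervalSpace) {J | |J.1.2 - s| < δ} :=
          measure_mono fun J (hJ : J.1.2 = s) => by simpa [hJ] using hδ
      _ ≤ _ := ProbabilityMeasure.le_liminf_measure_open_of_tendsto hμ hopen
      _ ≤ _ := liminf_le_of_frequently_le' hev.frequently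
  refine le_antisymm (ge_of_tendsto (x := 𝓝[>] (0 : ℝ))
    (f := fun δ : ℝ => ENNReal.ofReal (3 * δ)) ?_ ?_) bot_le
  · have : Tendsto (fun δ : ℝ => ENNReal.ofReal (3 * δ)) (𝓝 0) (𝓝 (ENNReal.ofReal (3 * 0))) :=
      (ENNReal.continuous_ofReal.comp (continuous_const.mul continuous_id)).tendsto 0
    simpa using this.mono_left nhdsWithin_le_nhds
  · filter_upwards [self_mem_nhdsWithin] with δ hδ using hle δ hδ

theorem exists_represents {G : ∀ n, SimpleGraph (Fin (n + 1))}
    {I : ∀ n, Fin (n + 1) → IntervalSpace} (hI : ∀ n, IsNormalizedModel (G n) (I n))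
    {Γ : GraphLimit} (hΓ : ∀ (k : ℕ) (F : SimpleGraph (Fin k)),
      Tendsto (fun n => homDensity F (G n)) atTop (𝓝 (Γ.density F))) :
    ∃ μ, Represents μ Γ := by
  -- Probability measures on the compact space of intervals form a compact space. An ultrafilter
  -- finer than `atTop` plays the role of a convergent subsequence.
  obtain ⟨μ, hμ⟩ := exists_clusterPt_of_compactSpace (map (fun n => empirical (I n)) atTop)
  obtain ⟨U, hU, hUμ⟩ := mapClusterPt_iff_ultrafilter.1 hμ
  refine ⟨μ, fun k F => tendsto_nhds_unique ((hΓ k F).mono_left hU) ?_⟩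
  have h1 := tendsto_measureDensity hUμ
    (measure_right_eq_zero_of_tendsto hI hU hUμ) F
  simpa using h1.sub ((tendsto_measureDensity_empirical_sub_homDensity
    (fun n => (hI n).isModel) F).mono_left hU)

/-- No weak convergence is needed: any subsequential limit `x` inherits both clique-density bounds
with respect to `Γ`, which force `x = ω(μ)`. -/
theorem tendsto_measureCliqueNumber_empirical {G : ∀ n, SimpleGraph (Fin (n + 1))}
    {I : ∀ n, Fin (n + 1) → IntervalSpace} (hI : ∀ n, IsModel (G n) (I n))
    {Γ : GraphLimit} (hΓ : ∀ (k : ℕ) (F : SimpleGraph (Fin k)),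
      Tendsto (fun n => homDensity F (G n)) atTop (𝓝 (Γ.density F)))
    {μ : ProbabilityMeasure IntervalSpace} (hμ : Represents μ Γ) :
    Tendsto (fun n => measureCliqueNumber (empirical (I n))) atTop
      (𝓝 (measureCliqueNumber μ)) := by
  have hdens : ∀ (k : ℕ) (F : SimpleGraph (Fin k)),
      Tendsto (fun n => measureDensity (empirical (I n)) F) atTop (𝓝 (Γ.density F)) :=
    fun k F => by
      simpa using (tendsto_measureDensity_empirical_sub_homDensity hI F).add (hΓ k F)
  refine tendsto_of_subseq_tendsto fun ns hns => ?_
  obtain ⟨x, hx, ms, hms, hlim⟩ := isCompact_Icc.tendsto_subseq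
    (x := fun n => measureCliqueNumber (empirical (I (ns n)))) (s := Set.Icc (0 : ℝ) 1)
    fun n => ⟨measureCliqueNumber_nonneg _, measureCliqueNumber_le_one _⟩
  refine ⟨ms, ?_⟩
  have hsub := hns.comp hms.tendsto_atTop
  rw [← hμ.eq_measureCliqueNumber hx.1 (fun k => ?_) fun k => ?_]
  · exact hlim
  · exact le_of_tendsto_of_tendsto' (hlim.pow k) ((hdens k ⊤).comp hsub)
      fun n => measureCliqueNumber_pow_le _ k
  · exact le_of_tendsto_of_tendsto' ((hdens (k + 1) ⊤).comp hsub)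
      ((hlim.pow k).const_mul ((k : ℝ) + 1)) fun n => measureDensity_top_le _ k

end IntervalGraphLimits

theorem theorem4p2
    (G : ∀ n : ℕ, SimpleGraph (Fin n))
    (hG : ∀ n, IntervalGraphLimits.IsIntervalGraph (G n))
    (Γ : IntervalGraphLimits.GraphLimit)
    (hΓ : IntervalGraphLimits.ConvergesTo G Γ) :
    -- `Γ` has a representing measure, and `ω(Γ) = ω(μ)` for every representing `μ`
    (∃ μ, IntervalGraphLimits.Represents μ Γ) ∧
    (∀ μ, IntervalGraphLimits.Represents μ Γ →
      Γ.cliqueNumber = IntervalGraphLimits.measureCliqueNumber μ) ∧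
    -- `χ(G_n) = ω(G_n)`, and both, divided by `n`, tend to `ω(Γ)`
    (∀ n, (G n).chromaticNumber = ((G n).cliqueNum : ℕ∞)) ∧
    Filter.Tendsto (fun n : ℕ => ((G n).chromaticNumber.toNat : ℝ) / (n : ℝ))
      Filter.atTop (nhds Γ.cliqueNumber) ∧
    Filter.Tendsto (fun n : ℕ => ((G n).cliqueNum : ℝ) / (n : ℝ))
      Filter.atTop (nhds Γ.cliqueNumber) := by
  choose I hI using fun n => (hG n).exists_isNormalizedModel
  -- The index is shifted by one because empirical measures need a nonempty vertex set.
  have hdens : ∀ (k : ℕ) (F : SimpleGraph (Fin k)), Tendsto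
      (fun n => IntervalGraphLimits.homDensity F (G (n + 1))) atTop (𝓝 (Γ.density F)) :=
    fun k F => (hΓ.2 k F).comp (tendsto_add_atTop_nat 1)
  have hχ : ∀ n, (G n).chromaticNumber = ((G n).cliqueNum : ℕ∞) :=
    fun n => (hI n).isModel.chromaticNumber_eq
  obtain ⟨μ, hμ⟩ := IntervalGraphLimits.exists_represents (fun n => hI (n + 1)) hdens
  have hω : Tendsto (fun n : ℕ => ((G n).cliqueNum : ℝ) / (n : ℝ)) atTop
      (𝓝 Γ.cliqueNumber) := by
    rw [← tendsto_add_atTop_iff_nat 1, hμ.cliqueNumber_eq]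
    simpa only [(hI _).isModel.measureCliqueNumber_empirical] using
      IntervalGraphLimits.tendsto_measureCliqueNumber_empirical
        (fun n => (hI (n + 1)).isModel) hdens hμ
  refine ⟨⟨μ, hμ⟩, fun ν hν => hν.cliqueNumber_eq, hχ, ?_, hω⟩
  simpa only [hχ, ENat.toNat_natCast] using hω
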